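/- **Setting.** Let $\mathcal H_{\mathbb R}=L^2_{\mathbb R}(\mathbb R_+)$, let $S(h)=l(h)+l(h)^*$, $h\in\mathcal H_{\mathbb R}$, be the semicircular operators on the full Fock space $\bigoplus_{n\ge 0}L^2(\mathbb R_+^n)$ ($l(h)\xi=h\otimes\xi$ the left creation operator, $\Omega$ the vacuum vector), let $\mathcal{SC}=\{S(h):h\in\mathcal H_{\mathbb R}\}''$ be the von Neumann algebra they generate, with trace $\tau(X)=\langle X\Omega,\Omega\rangle$, and let $\mathcal{SC}_{alg}$ be the unital $*$-algebra generated by the $S(h)$. Write $S_t=S(1_{[0,t]})$ for the free Brownian motion, and $I_n:L^2(\mathbb R_+^n)\to L^2(\mathcal{SC},\tau)$ for the multiple Wigner integral: the continuous linear extension of $1_{[u_1,v_1]\times\cdots\times[u_n,v_n]}\mapsto (S_{v_1}-S_{u_1})\cdots(S_{v_n}-S_{u_n})$, for boxes in $\mathbb R_+^n$ that do not meet the diagonals $\{t_i=t_j\}$, $i\ne j$ (with $I_0(c)=c\cdot 1$). For $n\ge 0$ let $\nabla^n:\mathcal{SC}_{alg}\to L^2(\mathbb R_+^n;L^2(\mathcal{SC}^{\otimes(n+1)},\tau^{\otimes(n+1)}))$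 be the iterated free Malliavin derivative: $\nabla^0=\mathrm{id}$, $\nabla=\nabla^1$ is the derivation $\nabla_t(AB)=A\cdot\nabla_tB+\nabla_tA\cdot B$ (with $A\cdot(X\otimes Y)=AX\otimes Y$, $(X\otimes Y)\cdot B=X\otimes YB$) such that $\nabla_t S(h)=h(t)\,1\otimes 1$, and $\nabla^n_{t_1,\dots,t_n}=(\mathrm{id}^{\otimes(n-1)}\otimes\nabla_{t_n})\circ\nabla^{n-1}_{t_1,\dots,t_{n-1}}$. Put $D^n=n!\,\nabla^n$. These operators are closable in $L^2(\mathcal{SC})$, and their closures are denoted in the same way. For $k\ge 1$ let $\mathbb D^{k,2,\sigma}\subset L^2(\mathcal{SC},\tau)$ be the completion of $\mathcal{SC}_{alg}$ for the norm $$\|F\|_{k,2,\sigma}=\Big(\|F\|_2^2+\sum_{j=1}^k\|D^jF\|^2_{L^2(\mathbb R_+^j;L^2(\mathcal{SC}^{\otimes(j+1)}))}\Big)^{1/2},\qquad \mathbb D^{\infty,2,\sigma}=\bigcap_{k\ge1}\mathbb D^{k,2,\sigma}.$$ The functional $\tau^{\otimes(n+1)}$ is extended continuously to $L^2(\mathcal{SC}^{\otimes(n+1)},\tau^{\otimes(n+1)})$.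 **Theorem (free Stroock formula).** Let $F\in\mathbb D^{\infty,2,\sigma}$ have the Wigner chaos expansion $F=\sum_{n=0}^\infty I_n(f_n)$, with $f_n\in L^2(\mathbb R_+^n)$ and convergence in $L^2(\mathcal{SC},\tau)$. Then for every $n\ge0$, $F$ is in the domains of (the closures of) $\nabla^n$ and $D^n$, and for Lebesgue-almost all $t_1,\dots,t_n\ge 0$, $$f_n(t_1,\dots,t_n)=\tau^{\otimes(n+1)}\big(\nabla^n_{t_1,\dots,t_n}F\big)=\frac1{n!}\,\tau^{\otimes(n+1)}\big(D^n_{t_1,\dots,t_n}F\big).$$ -/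

import Mathlib

open MeasureTheory Filter Topology
open scoped ENNReal TensorProduct InnerProductSpace ComplexConjugate

noncomputable section

namespace Wigner

/-! ### Spaces of square-integrable functions on `ℝ₊ⁿ` -/

/-- Lebesgue measure on the half line `ℝ₊ = [0, ∞)`. -/
abbrev leb : Measure ℝ := volume.restrict (Set.Ici 0)

/-- Lebesgue measure on `ℝ₊ⁿ`. -/
abbrev lebN (n : ℕ) : Measure (Fin n → ℝ) := Measure.pi fun _ => leb

/-- The real Hilbert space `L²_ℝ(ℝ₊)`. -/
abbrev HR : Type := Lp ℝ 2 leb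

/-- Its complexification `L²(ℝ₊)`. -/
abbrev HC : Type := Lp ℂ 2 leb

/-- `L²(ℝ₊ⁿ)`, the concrete model of the Hilbert tensor power `L²(ℝ₊)^{⊗ n}`. -/
abbrev L2N (n : ℕ) : Type := Lp ℂ 2 (lebN n)

/-- The inclusion `L²_ℝ(ℝ₊) → L²(ℝ₊)`. -/
def toHC (h : HR) : HC := RCLike.ofRealCLM.compLp h

lemma memLp_prepend {n : ℕ} (h : HC) (f : L2N n) :
    MemLp (fun t : Fin (n + 1) → ℝ => h (t 0) * f (Fin.tail t)) 2 (lebN (n + 1)) ∧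
    (∫ t : Fin (n + 1) → ℝ, ‖h (t 0) * f (Fin.tail t)‖ ^ 2 ∂(lebN (n + 1))) =
      (∫ t, ‖h t‖ ^ 2 ∂leb) * ∫ t, ‖f t‖ ^ 2 ∂(lebN n) := by
  have mp := measurePreserving_piFinSuccAbove (fun _ : Fin (n + 1) => leb) 0
  have hm : AEStronglyMeasurable (fun p : ℝ × (Fin n → ℝ) => h p.1 * f p.2)
      (leb.prod (lebN n)) :=
    ((Lp.aestronglyMeasurable h).comp_fst).mul ((Lp.aestronglyMeasurable f).comp_snd)
  have hi : Integrable (fun p : ℝ × (Fin n → ℝ) => ‖h p.1 * f p.2‖ ^ 2) (leb.prod (lebN n)) := by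
    have h1 := (memLp_two_iff_integrable_sq_norm (Lp.aestronglyMeasurable h)).1 (Lp.memLp h)
    have h2 := (memLp_two_iff_integrable_sq_norm (Lp.aestronglyMeasurable f)).1 (Lp.memLp f)
    simpa [mul_pow] using h1.mul_prod h2
  have hL : MemLp (fun p : ℝ × (Fin n → ℝ) => h p.1 * f p.2) 2 (leb.prod (lebN n)) :=
    (memLp_two_iff_integrable_sq_norm hm).2 hi
  constructor
  · exact hL.comp_measurePreserving mp
  · have := mp.integral_comp' (g := fun p : ℝ × (Fin n → ℝ) => ‖h p.1 * f p.2‖ ^ 2)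
    refine this.trans ?_
    simp only [norm_mul, mul_pow]
    exact integral_prod_mul (μ := leb) (ν := lebN n) (fun t => ‖h t‖ ^ 2) (fun t => ‖f t‖ ^ 2)

/-- The tensor product `h ⊗ f ∈ L²(ℝ₊ⁿ⁺¹)` of `h ∈ L²(ℝ₊)` and `f ∈ L²(ℝ₊ⁿ)`:
`(h ⊗ f)(t₀, t₁, …, tₙ) = h(t₀) f(t₁, …, tₙ)`. -/
def prepend {n : ℕ} (h : HC) (f : L2N n) : L2N (n + 1) := (memLp_prepend h f).1.toLp _

lemma norm_Lp_sq {α E : Type*} [MeasurableSpace α] {μ : Measure α} [NormedAddCommGroup E]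
    [InnerProductSpace ℂ E] (f : Lp E 2 μ) : ‖f‖ ^ 2 = ∫ a, ‖f a‖ ^ 2 ∂μ := by
  have h := inner_self_eq_norm_sq_to_K (𝕜 := ℂ) f
  rw [L2.inner_def] at h
  simp only [inner_self_eq_norm_sq_to_K] at h
  have : ((∫ a, ‖f a‖ ^ 2 ∂μ : ℝ) : ℂ) = ((‖f‖ ^ 2 : ℝ) : ℂ) := by
    rw [← integral_complex_ofReal]
    simpa using h
  exact_mod_cast this.symm

lemma norm_prepend {n : ℕ} (h : HC) (f : L2N n) : ‖prepend h f‖ = ‖h‖ * ‖f‖ := by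
  have h1 : ‖prepend h f‖ ^ 2 = (‖h‖ * ‖f‖) ^ 2 := by
    rw [mul_pow, norm_Lp_sq, norm_Lp_sq, norm_Lp_sq, ← (memLp_prepend h f).2]
    refine integral_congr_ae ?_
    filter_upwards [(memLp_prepend h f).1.coeFn_toLp] with t ht
    rw [prepend, ht]
  exact (sq_eq_sq₀ (norm_nonneg _) (by positivity)).1 h1

lemma tail_quasi (n : ℕ) :
    Measure.QuasiMeasurePreserving (fun t : Fin (n + 1) → ℝ => Fin.tail t)
      (lebN (n + 1)) (lebN n) := by
  have mp := measurePreserving_piFinSuccAbove (fun _ : Fin (n + 1) => leb) 0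
  have := (Measure.quasiMeasurePreserving_snd (μ := leb) (ν := lebN n)).comp
    mp.quasiMeasurePreserving
  exact this

lemma prepend_add {n : ℕ} (h : HC) (f g : L2N n) :
    prepend h (f + g) = prepend h f + prepend h g := by
  apply Lp.ext
  filter_upwards [(memLp_prepend h (f + g)).1.coeFn_toLp, (memLp_prepend h f).1.coeFn_toLp,
    (memLp_prepend h g).1.coeFn_toLp, Lp.coeFn_add (prepend h f) (prepend h g),
    (tail_quasi n).ae (Lp.coeFn_add f g)] with t h1 h2 h3 h4 h5
  rw [h4, Pi.add_apply]
  simp only [prepend]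
  rw [h1, h2, h3, h5, Pi.add_apply, mul_add]

lemma prepend_smul {n : ℕ} (h : HC) (c : ℂ) (f : L2N n) :
    prepend h (c • f) = c • prepend h f := by
  apply Lp.ext
  filter_upwards [(memLp_prepend h (c • f)).1.coeFn_toLp, (memLp_prepend h f).1.coeFn_toLp,
    Lp.coeFn_smul c (prepend h f), (tail_quasi n).ae (Lp.coeFn_smul c f)] with t h1 h2 h4 h5
  rw [h4, Pi.smul_apply]
  simp only [prepend]
  rw [h1, h2, h5, Pi.smul_apply, smul_eq_mul, smul_eq_mul]
  ring

/-- The elementary tensor `h₁ ⊗ ⋯ ⊗ hₙ ∈ L²(ℝ₊ⁿ)`,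
that is `(t₁, …, tₙ) ↦ h₁(t₁) ⋯ hₙ(tₙ)`. -/
def tensor : {n : ℕ} → (Fin n → HC) → L2N n
  | 0, _ => Lp.const 2 (lebN 0) 1
  | _ + 1, h => prepend (h 0) (tensor (Fin.tail h))

/-! ### The free Fock space and the semicircular operators -/

/-- The full Fock space `⨁ₙ L²(ℝ₊)^{⊗ n}` (Hilbert direct sum). -/
abbrev Fock : Type := lp (fun n : ℕ => L2N n) 2

/-- The vacuum vector. -/
def vac : Fock := lp.single 2 0 (Lp.const 2 (lebN 0) (1 : ℂ))

/-- The components of `h ⊗ ξ` for `ξ` in the Fock space. -/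
def createFun (h : HC) (ξ : Fock) : (n : ℕ) → L2N n
  | 0 => 0
  | n + 1 => prepend h (ξ n)

lemma summable_create (h : HC) (ξ : Fock) :
    Summable (fun n => ‖createFun h ξ n‖ ^ 2) ∧
      ∑' n, ‖createFun h ξ n‖ ^ 2 = ‖h‖ ^ 2 * ‖ξ‖ ^ 2 := by
  have h2 : (0 : ℝ) < (2 : ℝ≥0∞).toReal := by norm_num
  have hs := lp.hasSum_norm h2 ξ
  simp only [ENNReal.toReal_ofNat, Real.rpow_ofNat] at hs
  have hs' : HasSum (fun n => ‖createFun h ξ (n + 1)‖ ^ 2) (‖h‖ ^ 2 * ‖ξ‖ ^ 2) := by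
    simpa [createFun, norm_prepend, mul_pow] using hs.mul_left (‖h‖ ^ 2)
  have := (hasSum_nat_add_iff (f := fun n => ‖createFun h ξ n‖ ^ 2) 1).1 hs'
  have h3 : HasSum (fun n => ‖createFun h ξ n‖ ^ 2) (‖h‖ ^ 2 * ‖ξ‖ ^ 2) := by
    simpa [createFun] using this
  exact ⟨h3.summable, h3.tsum_eq⟩

/-- The vector `h ⊗ ξ` of the Fock space; in particular `h ⊗ Ω = h`. -/
def createVec (h : HC) (ξ : Fock) : Fock :=
  ⟨createFun h ξ, memℓp_gen (by simpa using (summable_create h ξ).1)⟩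

lemma createVec_apply (h : HC) (ξ : Fock) (n : ℕ) : createVec h ξ n = createFun h ξ n := rfl

lemma norm_createVec (h : HC) (ξ : Fock) : ‖createVec h ξ‖ = ‖h‖ * ‖ξ‖ := by
  have h2 : (0 : ℝ) < (2 : ℝ≥0∞).toReal := by norm_num
  have h1 := lp.norm_rpow_eq_tsum h2 (createVec h ξ)
  simp only [ENNReal.toReal_ofNat, Real.rpow_ofNat, createVec_apply] at h1
  have h3 := h1.trans (summable_create h ξ).2
  rw [← mul_pow] at h3
  exact (sq_eq_sq₀ (norm_nonneg _) (by positivity)).1 h3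

/-- The left creation operator `l(h)`, `l(h) ξ = h ⊗ ξ`. -/
def create (h : HC) : Fock →L[ℂ] Fock :=
  LinearMap.mkContinuous
    { toFun := createVec h
      map_add' := fun ξ η => by
        apply lp.ext
        funext n
        rw [lp.coeFn_add, Pi.add_apply]
        simp only [createVec_apply]
        cases n with
        | zero => simp [createFun]
        | succ n => simp [createFun, prepend_add]
      map_smul' := fun c ξ => by
        apply lp.ext
        funext n
        rw [RingHom.id_apply, lp.coeFn_smul, Pi.smul_apply]
        simp only [createVec_apply]
        cases n with
        | zero => simp [createFun]
        | succ n => simp [createFun, prepend_smul] }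
    ‖h‖ (fun ξ => (norm_createVec h ξ).le)

/-- The semicircular operator `S(h) = l(h) + l(h)*` for `h ∈ L²_ℝ(ℝ₊)`. -/
def semicirc (h : HR) : Fock →L[ℂ] Fock :=
  create (toHC h) + ContinuousLinearMap.adjoint (create (toHC h))

lemma semicirc_star (h : HR) : star (semicirc h) = semicirc h := by
  simp [semicirc, ContinuousLinearMap.star_eq_adjoint, add_comm]

/-- The von Neumann algebra `SC = {S(h) : h ∈ L²_ℝ(ℝ₊)}''`. -/
def SC : VonNeumannAlgebra Fock where
  toStarSubalgebra := StarSubalgebra.centralizer ℂ (Set.centralizer (Set.range semicirc))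
  centralizer_centralizer' := by simp

lemma coe_SC : (SC : Set (Fock →L[ℂ] Fock)) =
    Set.centralizer (Set.centralizer (Set.range semicirc)) := by
  have hs : star (Set.centralizer (Set.range semicirc)) = Set.centralizer (Set.range semicirc) := by
    have : star (Set.range semicirc) = Set.range semicirc := by
      ext x
      constructor
      · rintro ⟨h, hh⟩
        exact ⟨h, by rw [← semicirc_star, hh, star_star]⟩
      · rintro ⟨h, rfl⟩
        exact ⟨h, by rw [semicirc_star]⟩
    rw [Set.star_centralizer, this]
  change Set.centralizer (_ ∪ star _) = _
  rw [hs, Set.union_self]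

/-- The underlying `*`-algebra of `SC`. -/
abbrev SCAlg : Type := SC.toStarSubalgebra

/-- `S(h)` as an element of `SC`. -/
def S (h : HR) : SCAlg :=
  ⟨semicirc h, by
    have : semicirc h ∈ (SC : Set (Fock →L[ℂ] Fock)) := by
      rw [coe_SC]
      exact Set.subset_centralizer_centralizer ⟨h, rfl⟩
    exact this⟩

/-- The vacuum state `τ(X) = ⟨X Ω, Ω⟩`. -/
def trace : SCAlg →ₗ[ℂ] ℂ where
  toFun X := ⟪vac, (X : Fock →L[ℂ] Fock) vac⟫_ℂ
  map_add' X Y := by simp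
  map_smul' c X := by simp

lemma trace_star_mul (X Y : SCAlg) :
    trace (star X * Y) = ⟪(X : Fock →L[ℂ] Fock) vac, (Y : Fock →L[ℂ] Fock) vac⟫_ℂ := by
  change ⟪vac, (star (X : Fock →L[ℂ] Fock) * (Y : Fock →L[ℂ] Fock)) vac⟫_ℂ = _
  rw [ContinuousLinearMap.star_eq_adjoint, mul_apply_eq_comp,
    ContinuousLinearMap.adjoint_inner_right]

/-! ### The spaces `L²(SC^{⊗ n}, τ^{⊗ n})` -/

/-- The algebraic tensor power `SC ⊙ ⋯ ⊙ SC` (`n` factors). -/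
def AlgTensor (n : ℕ) : Type := PiTensorProduct ℂ (fun _ : Fin n => SCAlg)

instance (n : ℕ) : Ring (AlgTensor n) :=
  inferInstanceAs (Ring (PiTensorProduct ℂ (fun _ : Fin n => SCAlg)))

instance (n : ℕ) : Algebra ℂ (AlgTensor n) :=
  inferInstanceAs (Algebra ℂ (PiTensorProduct ℂ (fun _ : Fin n => SCAlg)))

/-- The elementary tensor `A₁ ⊗ ⋯ ⊗ Aₙ`. -/
def etensor {n : ℕ} (A : Fin n → SCAlg) : AlgTensor n := PiTensorProduct.tprod ℂ A

lemma etensor_mul {n : ℕ} (A B : Fin n → SCAlg) : etensor A * etensor B = etensor (A * B) :=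
  PiTensorProduct.tprod_mul_tprod A B

/-- The state `τ^{⊗ n}`, `A₁ ⊗ ⋯ ⊗ Aₙ ↦ τ(A₁) ⋯ τ(Aₙ)`. -/
def traceN (n : ℕ) : AlgTensor n →ₗ[ℂ] ℂ :=
  PiTensorProduct.lift
    ((MultilinearMap.mkPiAlgebra ℂ (Fin n) ℂ).compLinearMap fun _ => trace)

lemma traceN_etensor {n : ℕ} (A : Fin n → SCAlg) : traceN n (etensor A) = ∏ i, trace (A i) := by
  exact (PiTensorProduct.lift.tprod _).trans (by simp)

lemma star_update {n : ℕ} [DecidableEq (Fin n)] (f : Fin n → SCAlg) (i : Fin n) (m : SCAlg) :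
    star (Function.update f i m) = Function.update (star f) i (star m) := by
  funext j
  by_cases h : j = i
  · subst h; simp
  · simp [h]

/-- The adjoint on the algebraic tensor power, `A₁ ⊗ ⋯ ⊗ Aₙ ↦ A₁* ⊗ ⋯ ⊗ Aₙ*`, extended
antilinearly. -/
def starN (n : ℕ) : AlgTensor n →+ AlgTensor n :=
  PiTensorProduct.liftAddHom (fun p : ℂ × (Fin n → SCAlg) => conj p.1 • etensor (star p.2))
    (fun r f i hf => by
      have : etensor (star f) = 0 :=
        (PiTensorProduct.tprod ℂ).map_coord_zero i (by simp [hf])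
      simp [this])
    (fun f => by simp)
    (fun r f i m₁ m₂ => by
      simp only [star_update, star_add, ← smul_add]
      congr 1
      exact ((PiTensorProduct.tprod ℂ).map_update_add _ _ _ _).symm)
    (fun r r' f => by simp [add_smul])
    (fun r f i r' => by
      simp only [star_update, star_smul]
      have : etensor (Function.update (star f) i (star r' • star (f i))) =
          star r' • etensor (star f) := by
        have := (PiTensorProduct.tprod ℂ).map_update_smul (star f) i (star r') (star f i)
        rw [Function.update_eq_self] at this
        exact this
      rw [this]
      simp [smul_smul, mul_comm])

lemma starN_smul_etensor {n : ℕ} (c : ℂ) (A : Fin n → SCAlg) :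
    starN n (c • etensor A) = conj c • etensor (star A) := by
  have : c • etensor A = PiTensorProduct.tprodCoeff ℂ c A :=
    (PiTensorProduct.tprodCoeff_eq_smul_tprod c A).symm
  rw [this]
  exact (AddCon.lift_coe _ _).trans (by simp)

lemma AlgTensor.induction {n : ℕ} {p : AlgTensor n → Prop}
    (h : ∀ (c : ℂ) A, p (c • etensor A)) (ha : ∀ x y, p x → p y → p (x + y)) (x : AlgTensor n) :
    p x :=
  PiTensorProduct.induction_on x h ha

lemma starN_smul {n : ℕ} (c : ℂ) (x : AlgTensor n) : starN n (c • x) = conj c • starN n x := by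
  induction x using AlgTensor.induction with
  | h d A => rw [smul_smul, starN_smul_etensor, starN_smul_etensor, smul_smul, map_mul]
  | ha x y hx hy => rw [smul_add, map_add, map_add, hx, hy, smul_add]

lemma traceN_star_mul {n : ℕ} (c d : ℂ) (A B : Fin n → SCAlg) :
    traceN n (starN n (c • etensor A) * (d • etensor B)) =
      conj c * d * ∏ i, trace (star (A i) * B i) := by
  rw [starN_smul_etensor, smul_mul_smul_comm, etensor_mul, map_smul, traceN_etensor]
  rfl

lemma traceN_conj_symm {n : ℕ} (x y : AlgTensor n) :
    conj (traceN n (starN n y * x)) = traceN n (starN n x * y) := by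
  induction x using AlgTensor.induction with
  | ha x x' hx hx' => simp only [map_add, mul_add, add_mul, hx, hx']
  | h c A =>
    induction y using AlgTensor.induction with
    | ha y y' hy hy' => simp only [map_add, mul_add, add_mul, hy, hy']
    | h d B =>
      rw [traceN_star_mul, traceN_star_mul]
      simp only [map_mul, map_prod, trace_star_mul, inner_conj_symm, Complex.conj_conj]
      ring

open scoped ComplexOrder in
lemma schur_nonneg {𝕜 E ι κ : Type*} [RCLike 𝕜] [NormedAddCommGroup E] [InnerProductSpace 𝕜 E]
    [Fintype ι] (s : Finset κ) (v : κ → ι → E) (c : ι → 𝕜) :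
    0 ≤ RCLike.re (∑ i, ∑ j, conj (c i) * c j * ∏ k ∈ s, ⟪v k i, v k j⟫_𝕜) := by
  have hP : (Matrix.of fun i j : ι => ∏ k ∈ s, ⟪v k i, v k j⟫_𝕜).PosSemidef := by
    classical
    induction s using Finset.induction_on with
    | empty =>
      have := Matrix.posSemidef_gram 𝕜 (fun _ : ι => (1 : 𝕜))
      convert this using 1
      ext i j
      simp [Matrix.gram]
    | insert k s hk ih =>
      have := (Matrix.posSemidef_gram 𝕜 (v k)).hadamard ih
      convert this using 1
      ext i j
      simp [Matrix.gram, Finset.prod_insert hk]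
  have h := (RCLike.nonneg_iff.1 (hP.dotProduct_mulVec_nonneg c)).1
  convert h using 2
  simp only [dotProduct, Matrix.mulVec, Matrix.of_apply, Finset.mul_sum, Pi.star_apply,
    RCLike.star_def]
  exact Finset.sum_congr rfl fun i _ => Finset.sum_congr rfl fun j _ => by ring

lemma traceN_nonneg {n : ℕ} (x : AlgTensor n) : 0 ≤ (traceN n (starN n x * x)).re := by
  have hx : x ∈ Submodule.span ℂ (Set.range (etensor (n := n))) := by
    have : Submodule.span ℂ (Set.range (etensor (n := n))) = ⊤ :=
      PiTensorProduct.span_tprod_eq_top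
    rw [this]; trivial
  obtain ⟨c, rfl⟩ := Finsupp.mem_span_range_iff_exists_finsupp.1 hx
  have h := schur_nonneg (𝕜 := ℂ) (ι := c.support) Finset.univ
    (fun k A => ((A : Fin n → SCAlg) k : Fock →L[ℂ] Fock) vac) (fun A => c A)
  have h2 : traceN n (starN n (c.sum fun A a => a • etensor A) *
      (c.sum fun A a => a • etensor A)) =
      ∑ A : c.support, ∑ B : c.support, conj (c A) * c B *
        ∏ k, ⟪((A : Fin n → SCAlg) k : Fock →L[ℂ] Fock) vac,
          ((B : Fin n → SCAlg) k : Fock →L[ℂ] Fock) vac⟫_ℂ := by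
    simp only [Finsupp.sum, map_sum, Finset.sum_mul, Finset.mul_sum, traceN_star_mul,
      trace_star_mul]
    rw [Finset.sum_comm, ← Finset.sum_coe_sort]
    refine Finset.sum_congr rfl fun A _ => ?_
    rw [← Finset.sum_coe_sort]
  rw [h2]
  exact h

/-- The semi-inner product `⟨x, y⟩ = τ^{⊗ n}(x* y)` on the algebraic tensor power. -/
abbrev preInner (n : ℕ) : PreInnerProductSpace.Core ℂ (AlgTensor n) where
  inner x y := traceN n (starN n x * y)
  conj_inner_symm x y := traceN_conj_symm x y
  re_inner_nonneg x := traceN_nonneg x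
  add_left x y z := by rw [map_add, add_mul, map_add]
  smul_left x y c := by rw [starN_smul, smul_mul_assoc, map_smul, smul_eq_mul]

instance (n : ℕ) : SeminormedAddCommGroup (AlgTensor n) :=
  InnerProductSpace.Core.toSeminormedAddCommGroup (c := preInner n)

instance (n : ℕ) : InnerProductSpace ℂ (AlgTensor n) := InnerProductSpace.ofCore (preInner n)

lemma AlgTensor.inner_def {n : ℕ} (x y : AlgTensor n) : ⟪x, y⟫_ℂ = traceN n (starN n x * y) := rfl

/-- `L²(SC^{⊗ n}, τ^{⊗ n})`, the completion of `SC ⊙ ⋯ ⊙ SC` for the norm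
`‖x‖₂ = τ^{⊗ n}(x* x)^{1/2}`. In particular `L2SC 1` is `L²(SC, τ)`. -/
abbrev L2SC (n : ℕ) : Type := UniformSpace.Completion (AlgTensor n)

/-- The class of `A₁ ⊗ ⋯ ⊗ Aₙ` in `L²(SC^{⊗ n})`. -/
def cls {n : ℕ} (A : Fin n → SCAlg) : L2SC n := ((etensor A : AlgTensor n) : L2SC n)

/-- The continuous extension of `τ^{⊗ n}` to `L²(SC^{⊗ n})`, namely `x ↦ ⟨1, x⟩`. -/
def tau (n : ℕ) : L2SC n →L[ℂ] ℂ := innerSL ℂ (((1 : AlgTensor n) : L2SC n))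

lemma starN_one (n : ℕ) : starN n 1 = 1 := by
  have h1 : (1 : AlgTensor n) = (1 : ℂ) • etensor 1 := by rw [one_smul]; rfl
  rw [h1, starN_smul_etensor, map_one, star_one]

lemma tau_coe {n : ℕ} (x : AlgTensor n) : tau n (x : L2SC n) = traceN n x := by
  rw [tau, innerSL_apply_apply, UniformSpace.Completion.inner_coe, AlgTensor.inner_def,
    starN_one, one_mul]

/-! ### Multiple Wigner integrals -/

/-- The free Brownian motion `S_t = S(1_{[0,t]})`. -/
def brownian (t : ℝ) : SCAlg :=
  S (indicatorConstLp 2 (s := Set.Icc 0 t) measurableSet_Icc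
    (ne_top_of_le_ne_top (by simp) (Measure.restrict_apply_le _ _)) (1 : ℝ))

/-- The set of points of `ℝ₊ⁿ` at least two of whose coordinates agree. -/
def diagonals (n : ℕ) : Set (Fin n → ℝ) := {t | ∃ i j, i ≠ j ∧ t i = t j}

lemma box_ne_top {n : ℕ} (u v : Fin n → ℝ) : lebN n (Set.Icc u v) ≠ ∞ := by
  have : IsLocallyFiniteMeasure (lebN n) := inferInstance
  exact (isCompact_Icc.measure_lt_top).ne

/-- The graph of `I_n` on linear combinations of indicator functions of off-diagonal boxes:
the span of the pairs `(1_A, (S_{v₁} - S_{u₁}) ⋯ (S_{vₙ} - S_{uₙ}))` for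
`A = [u₁, v₁] × ⋯ × [uₙ, vₙ] ⊆ ℝ₊ⁿ` that do not meet the diagonals. -/
def simpleIntegralGraph (n : ℕ) : Submodule ℂ (L2N n × L2SC 1) :=
  Submodule.span ℂ {p | ∃ u v : Fin n → ℝ, 0 ≤ u ∧ u ≤ v ∧
    Disjoint (Set.Icc u v) (diagonals n) ∧
    p.1 = indicatorConstLp 2 (s := Set.Icc u v) measurableSet_Icc (box_ne_top u v) (1 : ℂ) ∧
    p.2 = cls fun _ => (List.ofFn fun i => brownian (v i) - brownian (u i)).prod}

/-- `X = I_n(f)`, where `I_n : L²(ℝ₊ⁿ) → L²(SC)` is the multiple Wigner integral: the continuous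
extension of its values on simple functions, given by its graph. -/
def IsWignerIntegral (n : ℕ) (f : L2N n) (X : L2SC 1) : Prop :=
  (f, X) ∈ (simpleIntegralGraph n).topologicalClosure

/-! ### Iterated free Malliavin derivatives -/

/-- `L²(ℝ₊ⁿ; L²(SC^{⊗ (n+1)}))`. -/
abbrev M (n : ℕ) : Type := Lp (L2SC (n + 1)) 2 (lebN n)

/-- The element `(t₁, …, tₙ) ↦ h₁(t₁) ⋯ hₙ(tₙ) A₁ ⊗ ⋯ ⊗ A_{n+1}`. -/
def emult {n : ℕ} (h : Fin n → HR) (A : Fin (n + 1) → SCAlg) : M n :=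
  (ContinuousLinearMap.toSpanSingleton ℂ (cls A)).compLp (tensor fun i => toHC (h i))

/-- A word `[e₁, …, e_k]`, which stands for the product `S(e₁) ⋯ S(e_k)`. -/
abbrev Word : Type := List HR

/-- `S(e₁) ⋯ S(e_k)`. -/
def evalWord (w : Word) : SCAlg := (w.map S).prod

/-- The free Malliavin derivative of a word. A triple `(a, h, b)` stands for `h(t) a ⊗ b`, a list
for the sum of its entries. The second clause is the Leibniz rule
`∇_t (S(h) w) = h(t) 1 ⊗ w + S(h) ∇_t w`. -/
def gradWord : Word → List (Word × HR × Word)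
  | [] => []
  | h :: w => ([], h, w) :: (gradWord w).map fun p => (h :: p.1, p.2.1, p.2.2)

/-- The Leibniz rule `∇_t (v w) = ∇_t v · w + v · ∇_t w`. -/
lemma gradWord_append (v w : Word) : gradWord (v ++ w) =
    (gradWord v).map (fun p => (p.1, p.2.1, p.2.2 ++ w)) ++
      (gradWord w).map (fun p => (v ++ p.1, p.2.1, p.2.2)) := by
  induction v with
  | nil => simp [gradWord]
  | cons h v ih => simp [gradWord, ih, Function.comp_def]

/-- The iterated derivative of a word,
`∇ⁿ_{t₁,…,tₙ} = (id^{⊗ (n-1)} ⊗ ∇_{tₙ}) ∘ ∇ⁿ⁻¹_{t₁,…,t_{n-1}}`. A pair `(h, w)` stands for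
`h₁(t₁) ⋯ hₙ(tₙ) w₁ ⊗ ⋯ ⊗ w_{n+1}`, a list for the sum of its entries. -/
def gradWordN : (n : ℕ) → Word → List ((Fin n → HR) × (Fin (n + 1) → Word))
  | 0, w => [(Fin.elim0, fun _ => w)]
  | n + 1, w => (gradWordN n w).flatMap fun p =>
      (gradWord (p.2 (Fin.last n))).map fun q =>
        (Fin.snoc p.1 q.2.1, Fin.snoc (Fin.snoc (Fin.init p.2) q.1) q.2.2)

/-- Noncommutative polynomials in the symbols `S(h)`, `h ∈ L²_ℝ(ℝ₊)`: formal linear combinations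
of words. -/
abbrev Poly : Type := Word →₀ ℂ

/-- The class in `L²(SC)` of the element of `SC_alg`, the unital `*`-algebra generated by the
`S(h)`, that is represented by a polynomial. -/
def eval : Poly →ₗ[ℂ] L2SC 1 := Finsupp.linearCombination ℂ fun w => cls fun _ => evalWord w

/-- `∇ⁿ` of the element of `SC_alg` represented by a polynomial. -/
def gradPoly (n : ℕ) : Poly →ₗ[ℂ] M n :=
  Finsupp.linearCombination ℂ fun w =>
    ((gradWordN n w).map fun p => emult p.1 fun i => evalWord (p.2 i)).sum

/-- The symmetrized derivative `Dⁿ = n! ∇ⁿ`. -/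
def symPoly (n : ℕ) : Poly →ₗ[ℂ] M n := (n.factorial : ℂ) • gradPoly n

/-- `U = ∇ⁿ F`, for the closure of `∇ⁿ : SC_alg → L²(ℝ₊ⁿ; L²(SC^{⊗ (n+1)}))`: the pair `(F, U)`
belongs to the closure of the graph. -/
def IsGrad (n : ℕ) (F : L2SC 1) (U : M n) : Prop :=
  (F, U) ∈ (LinearMap.range (eval.prod (gradPoly n))).topologicalClosure

/-- `U = Dⁿ F`, for the closure of `Dⁿ` on `SC_alg`. -/
def IsSymGrad (n : ℕ) (F : L2SC 1) (U : M n) : Prop :=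
  (F, U) ∈ (LinearMap.range (eval.prod (symPoly n))).topologicalClosure

/-- The norm `‖F‖_{k,2,σ} = (‖F‖₂² + ∑_{j=1}^k ‖D^j F‖²)^{1/2}` on `SC_alg`. -/
def sobolevNorm (k : ℕ) (P : Poly) : ℝ :=
  √(‖eval P‖ ^ 2 + ∑ j ∈ Finset.Icc 1 k, ‖symPoly j P‖ ^ 2)

/-- The Sobolev–Wigner space `𝔻^{k,2,σ}`, the completion of `SC_alg` for `‖·‖_{k,2,σ}`, realized
in `L²(SC)`: limits in `L²(SC)` of sequences in `SC_alg` that are Cauchy for `‖·‖_{k,2,σ}`. -/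
def sobolev (k : ℕ) : Set (L2SC 1) :=
  {F | ∃ P : ℕ → Poly, Tendsto (fun m => eval (P m)) atTop (𝓝 F) ∧
    ∀ ε > 0, ∃ N, ∀ m ≥ N, ∀ m' ≥ N, sobolevNorm k (P m - P m') < ε}

/-- `𝔻^{∞,2,σ} = ⋂_{k ≥ 1} 𝔻^{k,2,σ}`. -/
def sobolevInf : Set (L2SC 1) := ⋂ k ≥ 1, sobolev k

end Wigner

end

noncomputable section

namespace Wigner

/-! ### Coassociativity of the derivative on words -/

/-! The map `X ↦ X Ω` extends to `toFock`, from `L²(SC, τ)` to the Fock space. The increments over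
an off-diagonal box are semicirculars of pairwise orthogonal vectors, so their product sends `Ω` to
an elementary tensor. Hence `I_n(f)` becomes `f` placed in degree `n`
(`IsWignerIntegral.toFock_eq`), and `f_n` is the degree `n` component of the image of `F`
(`chaos_eq_of_hasSum`).

It remains to compute these components from derivatives. The core is `wordVec_expansion`: `S(w) Ω =
τ(w) Ω + ∑ τ(a) l(h) S(b) Ω`, summed over the terms `h a ⊗ b` of `∇ w`. To add a letter `e`, apply
`l(e) + l(e)*`. The creation part supplies the new Leibniz term; the annihilation part contracts by
`l(g)* l(h) = ⟨g, h⟩` and leaves vectors `S(b) Ω` that are expanded again. Coassociativity of `∇`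
regroups the resulting double sum, and its coefficients are moments by the Schwinger–Dyson equation.
Iterating on the right leg `b` peels off one tensor factor at a time, which gives `wordVec_apply`:
degree `n` of `S(w) Ω` is the trace of `∇ⁿ w`.

Both sides of this identity are continuous in the pair (element, derivative), so it holds on the
whole closure of the graph (`IsGrad.tauM_eq`, `IsSymGrad.tauM_eq`), for every candidate derivative
and without appeal to closability. Existence of derivatives is completeness applied to a
Sobolev–Cauchy sequence. -/

/-- Coassociativity `(∇ ⊗ id) ∘ ∇ = (id ⊗ ∇) ∘ ∇` of the free difference quotient on words. -/
lemma gradWord_coassoc {V : Type*} [AddCommMonoid V] (w : Word)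
    (G : Word → HR → Word → HR → Word → V) :
    ((gradWord w).map fun p =>
        ((gradWord p.2.2).map fun q => G p.1 p.2.1 q.1 q.2.1 q.2.2).sum).sum =
      ((gradWord w).map fun p =>
        ((gradWord p.1).map fun q => G q.1 q.2.1 q.2.2 p.2.1 p.2.2).sum).sum := by
  induction w generalizing G with
  | nil => simp [gradWord]
  | cons e w ih =>
    -- The terms in which `e` itself is differentiated agree on both sides; in all others `e` stays
    -- in the leftmost leg, where `G` can absorb it.
    have := ih (fun a => G (e :: a))
    simp only [gradWord, List.map_cons, List.map_map, List.sum_cons, List.map_nil, List.sum_nil,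
      Function.comp_def, zero_add, List.sum_map_add] at this ⊢
    rw [this]

/-- Differentiation consumes one letter. This allows the induction on length in `wordVec_expansion`
to recurse into both legs. -/
lemma length_gradWord {w : Word} {p : Word × HR × Word} (hp : p ∈ gradWord w) :
    p.1.length < w.length ∧ p.2.2.length < w.length := by
  induction w generalizing p with
  | nil => simp [gradWord] at hp
  | cons e w ih =>
    simp only [gradWord, List.mem_cons, List.mem_map] at hp
    rcases hp with rfl | ⟨q, hq, rfl⟩
    · simp
    · have := ih hq
      simp only [List.length_cons]
      omega

/-- The iterated derivative, starting with the leftmost factor. -/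
lemma gradWordN_succ (n : ℕ) (w : Word) :
    gradWordN (n + 1) w = (gradWord w).flatMap fun p =>
      (gradWordN n p.2.2).map fun q => (Fin.cons p.2.1 q.1, Fin.cons p.1 q.2) := by
  induction n generalizing w with
  | zero =>
    simp only [gradWordN, List.flatMap_cons, List.flatMap_nil, List.append_nil, List.map_cons,
      List.map_nil]
    rw [← List.map_eq_flatMap]
    refine List.map_congr_left fun q _ => ?_
    refine Prod.ext ?_ ?_
    · funext i
      fin_cases i
      rfl
    · funext i
      fin_cases i <;> rfl
  | succ n ih =>
    rw [gradWordN, ih, List.flatMap_assoc]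
    refine List.flatMap_congr fun p _ => ?_
    rw [gradWordN, List.flatMap_map, List.map_flatMap]
    refine List.flatMap_congr fun q _ => ?_
    rw [List.map_map]
    -- Adjoining a leg on the left does not change the last leg, which is the one differentiated
    -- next.
    have hl : (Fin.cons p.1 q.2 : Fin (n + 2) → Word) (Fin.last (n + 1)) = q.2 (Fin.last n) := by
      rw [← Fin.succ_last, Fin.cons_succ]
    dsimp only
    rw [hl]
    refine List.map_congr_left fun r _ => ?_
    refine Prod.ext ?_ ?_
    · exact (Fin.cons_snoc_eq_snoc_cons _ _ _).symm
    · simp only [Function.comp_apply]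
      rw [Fin.cons_snoc_eq_snoc_cons, Fin.cons_snoc_eq_snoc_cons]
      congr 2
      funext i
      refine Fin.cases ?_ (fun j => ?_) i <;> rfl

/-! ### Elementary tensors and creation operators -/

lemma inner_prepend {n : ℕ} (g h : HC) (f f' : L2N n) :
    ⟪prepend g f, prepend h f'⟫_ℂ = ⟪g, h⟫_ℂ * ⟪f, f'⟫_ℂ := by
  have mp := measurePreserving_piFinSuccAbove (fun _ : Fin (n + 1) => leb) 0
  simp only [L2.inner_def]
  rw [← integral_prod_mul (μ := leb) (ν := lebN n) (fun t => ⟪g t, h t⟫_ℂ) (fun t => ⟪f t, f' t⟫_ℂ)]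
  refine Eq.trans ?_ (mp.integral_comp' (g := fun p : ℝ × (Fin n → ℝ) =>
    ⟪g p.1, h p.1⟫_ℂ * ⟪f p.2, f' p.2⟫_ℂ))
  refine integral_congr_ae ?_
  filter_upwards [(memLp_prepend g f).1.coeFn_toLp, (memLp_prepend h f').1.coeFn_toLp]
    with t h1 h2
  simp only [prepend]
  rw [h1, h2]
  have : (MeasurableEquiv.piFinSuccAbove (fun _ : Fin (n + 1) => ℝ) 0) t =
    (t 0, Fin.tail t) := rfl
  rw [this]
  simp only [RCLike.inner_apply, map_mul]
  ring

lemma eval_zero_quasi (n : ℕ) :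
    Measure.QuasiMeasurePreserving (fun t : Fin (n + 1) → ℝ => t 0) (lebN (n + 1)) leb := by
  have mp := measurePreserving_piFinSuccAbove (fun _ : Fin (n + 1) => leb) 0
  have := (Measure.quasiMeasurePreserving_fst (μ := leb) (ν := lebN n)).comp
    mp.quasiMeasurePreserving
  exact this

lemma prepend_sub_left {n : ℕ} (g h : HC) (f : L2N n) :
    prepend (g - h) f = prepend g f - prepend h f := by
  apply Lp.ext
  filter_upwards [(memLp_prepend (g - h) f).1.coeFn_toLp, (memLp_prepend g f).1.coeFn_toLp,
    (memLp_prepend h f).1.coeFn_toLp, Lp.coeFn_sub (prepend g f) (prepend h f),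
    (eval_zero_quasi n).ae (Lp.coeFn_sub g h)] with t h1 h2 h3 h4 h5
  rw [h4, Pi.sub_apply]
  simp only [prepend]
  rw [h1, h2, h3, h5, Pi.sub_apply, sub_mul]

lemma create_apply_zero (h : HC) (ξ : Fock) : create h ξ 0 = 0 := rfl

lemma create_apply_succ (h : HC) (ξ : Fock) (n : ℕ) : create h ξ (n + 1) = prepend h (ξ n) := rfl

lemma create_sub (g h : HC) : create (g - h) = create g - create h := by
  ext1 ξ
  apply lp.ext
  funext n
  rw [sub_apply, lp.coeFn_sub, Pi.sub_apply]
  cases n with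
  | zero => simp [create_apply_zero]
  | succ n => simp only [create_apply_succ, prepend_sub_left]

lemma inner_create (g h : HC) (ξ η : Fock) :
    ⟪create g ξ, create h η⟫_ℂ = ⟪g, h⟫_ℂ * ⟪ξ, η⟫_ℂ := by
  have h1 := lp.hasSum_inner (𝕜 := ℂ) (create g ξ) (create h η)
  have h2 := (lp.hasSum_inner (𝕜 := ℂ) ξ η).mul_left ⟪g, h⟫_ℂ
  have h3 : HasSum (fun n => ⟪create g ξ (n + 1), create h η (n + 1)⟫_ℂ)
      (⟪g, h⟫_ℂ * ⟪ξ, η⟫_ℂ) := by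
    simpa only [create_apply_succ, inner_prepend] using h2
  have h4 := (hasSum_nat_add_iff (f := fun n => ⟪create g ξ n, create h η n⟫_ℂ) 1).1 h3
  refine h1.unique ?_
  simpa [create_apply_zero] using h4

/-- The free Fock relation `l(g)* l(h) = ⟨g, h⟩`. -/
lemma adjoint_create_create (g h : HC) (ξ : Fock) :
    ContinuousLinearMap.adjoint (create g) (create h ξ) = ⟪g, h⟫_ℂ • ξ := by
  refine ext_inner_left ℂ fun η => ?_
  rw [ContinuousLinearMap.adjoint_inner_right, inner_create, inner_smul_right]

lemma inner_vac (ξ : Fock) : ⟪vac, ξ⟫_ℂ = ⟪(Lp.const 2 (lebN 0) (1 : ℂ) : L2N 0), ξ 0⟫_ℂ :=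
  lp.inner_single_left _ _ _

lemma adjoint_create_vac (g : HC) : ContinuousLinearMap.adjoint (create g) vac = 0 := by
  refine ext_inner_right ℂ fun η => ?_
  rw [ContinuousLinearMap.adjoint_inner_left, inner_vac, create_apply_zero, inner_zero_right,
    inner_zero_left]

lemma inner_vac_vac : ⟪vac, vac⟫_ℂ = 1 := by
  have h : ‖(Lp.const 2 (lebN 0) (1 : ℂ) : L2N 0)‖ = 1 := by
    rw [Lp.norm_const' _ _ _ two_ne_zero ENNReal.ofNat_ne_top]
    simp [measureReal_def]
  rw [inner_self_eq_norm_sq_to_K, vac, lp.norm_single (by norm_num), h]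
  simp

lemma inner_vac_create (h : HC) (ξ : Fock) : ⟪vac, create h ξ⟫_ℂ = 0 := by
  rw [inner_vac, create_apply_zero, inner_zero_right]

/-! ### Moments of semicircular elements -/

/-- The vector `S(e₁) ⋯ S(e_k) Ω`. -/
def wordVec (w : Word) : Fock := (evalWord w : Fock →L[ℂ] Fock) vac

/-- The moment `τ(S(e₁) ⋯ S(e_k))`. -/
def moment (w : Word) : ℂ := trace (evalWord w)

lemma moment_eq (w : Word) : moment w = ⟪vac, wordVec w⟫_ℂ := rfl

lemma wordVec_nil : wordVec [] = vac := rfl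

lemma wordVec_cons (e : HR) (w : Word) : wordVec (e :: w) =
    create (toHC e) (wordVec w) + ContinuousLinearMap.adjoint (create (toHC e)) (wordVec w) := by
  simp only [wordVec, evalWord, List.map_cons, List.prod_cons]
  rfl

/-- The expansion of `l(e)* ξ`, for `ξ` given by its first chaos expansion. -/
lemma adjoint_create_of_expansion (e : HR) (w : Word)
    (h : wordVec w = moment w • vac +
      ((gradWord w).map fun p => moment p.1 • create (toHC p.2.1) (wordVec p.2.2)).sum) :
    ContinuousLinearMap.adjoint (create (toHC e)) (wordVec w) =
      ((gradWord w).map fun p =>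
        (moment p.1 * ⟪toHC e, toHC p.2.1⟫_ℂ) • wordVec p.2.2).sum := by
  rw [h, map_add, map_smul, adjoint_create_vac, smul_zero, zero_add, map_list_sum, List.map_map]
  simp only [Function.comp_def, map_smul, adjoint_create_create, smul_smul]

/-- `S(w) Ω = τ(w) Ω + ∑ τ(a) l(h) S(b) Ω`, summed over `∇ w = ∑ h a ⊗ b`. -/
theorem wordVec_expansion (w : Word) : wordVec w = moment w • vac +
    ((gradWord w).map fun p => moment p.1 • create (toHC p.2.1) (wordVec p.2.2)).sum := by
  induction hk : w.length using Nat.strong_induction_on generalizing w with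
  | _ k ih =>
    subst hk
    cases w with
    | nil =>
      rw [moment_eq, wordVec_nil, inner_vac_vac, one_smul, gradWord, List.map_nil, List.sum_nil,
        add_zero]
    | cons e w =>
      -- Schwinger–Dyson equation: only `l(e)*` contributes, since the range of `l(e)` is orthogonal
      -- to `Ω`. It is used for `w` and for the left legs of `∇ w`, hence the general `v`.
      have hSD : ∀ v : Word, v.length ≤ w.length → moment (e :: v) =
          ((gradWord v).map fun p =>
            moment p.1 * ⟪toHC e, toHC p.2.1⟫_ℂ * moment p.2.2).sum := by
        intro v hv
        rw [moment_eq, wordVec_cons, inner_add_right, inner_vac_create, zero_add,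
          adjoint_create_of_expansion e v
            (ih v.length (by simp only [List.length_cons]; omega) v rfl)]
        rw [← innerSL_apply_apply ℂ, map_list_sum, List.map_map]
        simp only [Function.comp_def, map_smul, innerSL_apply_apply, smul_eq_mul, moment_eq]
      have hw := adjoint_create_of_expansion e w
        (ih w.length (by simp only [List.length_cons]; omega) w rfl)
      -- Expanding each remaining `S(b) Ω` separates the vacuum part of `l(e)* S(w) Ω` from a sum
      -- over `(id ⊗ ∇) ∇ w`.
      have h1 : ((gradWord w).map fun p =>
          (moment p.1 * ⟪toHC e, toHC p.2.1⟫_ℂ) • wordVec p.2.2).sum =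
          ((gradWord w).map fun p =>
            (moment p.1 * ⟪toHC e, toHC p.2.1⟫_ℂ * moment p.2.2) • vac).sum +
          ((gradWord w).map fun p => ((gradWord p.2.2).map fun q =>
            (moment p.1 * ⟪toHC e, toHC p.2.1⟫_ℂ * moment q.1) •
              create (toHC q.2.1) (wordVec q.2.2)).sum).sum := by
        rw [← List.sum_map_add]
        refine congrArg List.sum (List.map_congr_left fun p hp => ?_)
        have hl := (length_gradWord hp).2
        conv_lhs => rw [ih p.2.2.length (by simp only [List.length_cons]; omega) p.2.2 rfl]
        rw [smul_add, smul_smul, List.smul_sum, List.map_map]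
        simp only [Function.comp_def, smul_smul]
      -- The target coefficients `τ(e a)` unfold by Schwinger–Dyson into a sum over `(∇ ⊗ id) ∇ w`,
      -- which coassociativity matches with the double sum of `h1`.
      have h2 : ((gradWord w).map fun p =>
          moment (e :: p.1) • create (toHC p.2.1) (wordVec p.2.2)).sum =
          ((gradWord w).map fun p => ((gradWord p.1).map fun q =>
            (moment q.1 * ⟪toHC e, toHC q.2.1⟫_ℂ * moment q.2.2) •
              create (toHC p.2.1) (wordVec p.2.2)).sum).sum := by
        refine congrArg List.sum (List.map_congr_left fun p hp => ?_)
        rw [hSD p.1 (length_gradWord hp).1.le, List.sum_smul, List.map_map]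
        rfl
      have h3 := gradWord_coassoc w fun a h a' h' b' =>
        (moment a * ⟪toHC e, toHC h⟫_ℂ * moment a') • create (toHC h') (wordVec b')
      have h4 : ((gradWord w).map fun p =>
          (moment p.1 * ⟪toHC e, toHC p.2.1⟫_ℂ * moment p.2.2) • vac).sum =
          moment (e :: w) • vac := by
        rw [hSD w le_rfl, List.sum_smul, List.map_map]
        rfl
      -- The new Leibniz term `e 1 ⊗ w` has weight `τ(1) = 1`, so it is exactly `l(e) S(w) Ω`.
      have h5 : moment [] = 1 := inner_vac_vac
      rw [wordVec_cons, hw, h1, h3, ← h2, h4]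
      simp only [gradWord, List.map_cons, List.map_map, List.sum_cons, Function.comp_def, h5,
        one_smul]
      abel

lemma vac_apply_succ (n : ℕ) : vac (n + 1) = 0 :=
  lp.single_apply_ne _ _ _ (Nat.succ_ne_zero n)

lemma vac_apply_zero : vac 0 = Lp.const 2 (lebN 0) (1 : ℂ) :=
  lp.single_apply_self _ _ _

lemma coordinate_list_sum (n : ℕ) (l : List Fock) : l.sum n = (l.map fun ξ : Fock => ξ n).sum := by
  induction l with
  | nil => rfl
  | cons a l ih => rw [List.sum_cons, List.map_cons, List.sum_cons, ← ih]; rfl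

/-- The chaos components of `S(w) Ω` are the vacuum expectations of the iterated derivatives. -/
theorem wordVec_apply (n : ℕ) (w : Word) : wordVec w n =
    ((gradWordN n w).map fun p =>
      (∏ i, moment (p.2 i)) • tensor fun i => toHC (p.1 i)).sum := by
  induction n generalizing w with
  | zero =>
    rw [wordVec_expansion, lp.coeFn_add, Pi.add_apply, coordinate_list_sum, List.map_map,
      lp.coeFn_smul, Pi.smul_apply, vac_apply_zero]
    simp [gradWordN, Function.comp_def, create_apply_zero, tensor]
  | succ n ih =>
    -- In positive degree the vacuum term drops out, and `l(h)` raises degree by one, so degree `n`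
    -- of `S(b) Ω` is what is needed.
    rw [wordVec_expansion, lp.coeFn_add, Pi.add_apply, coordinate_list_sum, List.map_map,
      lp.coeFn_smul, Pi.smul_apply, vac_apply_succ, smul_zero, zero_add, gradWordN_succ,
      List.map_flatMap, List.flatMap_def, List.sum_flatten, List.map_map]
    refine congrArg List.sum (List.map_congr_left fun p _ => ?_)
    simp only [Function.comp_def, List.map_map]
    rw [lp.coeFn_smul, Pi.smul_apply, create_apply_succ, ih]
    have : ∀ l : List (L2N n), prepend (toHC p.2.1) l.sum =
        (l.map (prepend (toHC p.2.1))).sum := by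
      intro l
      exact map_list_sum (⟨⟨prepend (toHC p.2.1), by simpa using prepend_smul (toHC p.2.1) 0 0⟩,
        prepend_add _⟩ : L2N n →+ L2N (n + 1)) l
    rw [this, List.map_map, List.smul_sum, List.map_map]
    refine congrArg List.sum (List.map_congr_left fun q _ => ?_)
    simp only [Function.comp_apply]
    rw [prepend_smul, smul_smul, Fin.prod_univ_succ (n := n + 1)]
    rfl

/-! ### The embedding of `L²(SC, τ)` into the Fock space -/

/-- The map `X ↦ X Ω` on `SC`, viewed as the tensor power with one factor. -/
def algToFock : AlgTensor 1 →ₗ[ℂ] Fock :=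
  PiTensorProduct.lift
    ((MultilinearMap.ofSubsingleton ℂ SCAlg Fock (0 : Fin 1))
      { toFun := fun X => (X : Fock →L[ℂ] Fock) vac
        map_add' := fun _ _ => rfl
        map_smul' := fun _ _ => rfl })

lemma algToFock_etensor (A : Fin 1 → SCAlg) :
    algToFock (etensor A) = (A 0 : Fock →L[ℂ] Fock) vac :=
  PiTensorProduct.lift.tprod _

/-- With a single factor, scalars and sums can be absorbed into that factor. Isometry of `algToFock`
then needs checking on elementary tensors only. -/
lemma exists_eq_etensor (x : AlgTensor 1) : ∃ A : SCAlg, x = etensor fun _ => A := by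
  induction x using AlgTensor.induction with
  | h c A =>
    refine ⟨c • A 0, ?_⟩
    have h := (PiTensorProduct.tprod ℂ (s := fun _ : Fin 1 => SCAlg)).map_update_smul A 0 c (A 0)
    rw [Function.update_eq_self] at h
    refine h.symm.trans (congrArg etensor (funext fun i => ?_))
    rw [Subsingleton.elim i 0, Function.update_self]
  | ha x y hx hy =>
    obtain ⟨A, rfl⟩ := hx
    obtain ⟨B, rfl⟩ := hy
    refine ⟨A + B, ?_⟩
    have h := (PiTensorProduct.tprod ℂ (s := fun _ : Fin 1 => SCAlg)).map_update_add
      (fun _ => A) 0 A B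
    have e : ∀ C : SCAlg, Function.update (fun _ : Fin 1 => A) 0 C = fun _ => C := fun C =>
      funext fun i => by rw [Subsingleton.elim i 0, Function.update_self]
    rw [e, e, e] at h
    exact h.symm

/-- The GNS identity `τ(A* A) = ‖A Ω‖²`. -/
lemma norm_algToFock (x : AlgTensor 1) : ‖algToFock x‖ = ‖x‖ := by
  obtain ⟨A, rfl⟩ := exists_eq_etensor x
  have h : ⟪algToFock (etensor fun _ => A), algToFock (etensor fun _ => A)⟫_ℂ =
      ⟪(etensor fun _ => A : AlgTensor 1), etensor fun _ => A⟫_ℂ := by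
    rw [algToFock_etensor, AlgTensor.inner_def]
    have := traceN_star_mul (n := 1) 1 1 (fun _ => A) (fun _ => A)
    rw [one_smul] at this
    rw [this, Fin.prod_univ_one, trace_star_mul]
    simp
  rw [inner_self_eq_norm_sq_to_K, inner_self_eq_norm_sq_to_K] at h
  have h2 : ‖algToFock (etensor fun _ => A)‖ ^ 2 = ‖(etensor fun _ => A : AlgTensor 1)‖ ^ 2 := by
    exact_mod_cast h
  exact (sq_eq_sq₀ (norm_nonneg _) (norm_nonneg _)).1 h2

/-- The continuous extension `L²(SC, τ) → Fock` of `X ↦ X Ω`. -/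
def toFock : L2SC 1 →L[ℂ] Fock :=
  (algToFock.mkContinuous 1 fun x => by rw [norm_algToFock, one_mul]).extend
    (UniformSpace.Completion.toComplL (𝕜 := ℂ) (E := AlgTensor 1))

lemma toFock_cls (A : Fin 1 → SCAlg) : toFock (cls A) = (A 0 : Fock →L[ℂ] Fock) vac := by
  refine (ContinuousLinearMap.extend_eq _ UniformSpace.Completion.denseRange_coe
    (UniformSpace.Completion.isUniformInducing_coe (AlgTensor 1)) (etensor A)).trans ?_
  exact algToFock_etensor A

/-! ### Wigner integrals as chaos components -/

lemma toHC_sub (g h : HR) : toHC (g - h) = toHC g - toHC h :=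
  map_sub ((RCLike.ofRealCLM : ℝ →L[ℝ] ℂ).compLpL 2 leb) g h

lemma S_sub (g h : HR) : S (g - h) = S g - S h := by
  refine Subtype.ext ?_
  change semicirc (g - h) = semicirc g - semicirc h
  simp only [semicirc, toHC_sub, create_sub, map_sub]
  abel

/-- The increment `1_{[0,v]} - 1_{[0,u]}`. -/
def increment (u v : ℝ) : HR :=
  indicatorConstLp 2 (s := Set.Icc 0 v) measurableSet_Icc
    (ne_top_of_le_ne_top (by simp) (Measure.restrict_apply_le _ _)) (1 : ℝ) -
  indicatorConstLp 2 (s := Set.Icc 0 u) measurableSet_Icc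
    (ne_top_of_le_ne_top (by simp) (Measure.restrict_apply_le _ _)) (1 : ℝ)

lemma brownian_sub (u v : ℝ) : brownian v - brownian u = S (increment u v) :=
  (S_sub _ _).symm

/-- The difference of indicators is that of `(u, v]` on the half line; the endpoint `u` is a null
set. -/
lemma toHC_increment {u v : ℝ} (huv : u ≤ v) :
    toHC (increment u v) =ᵐ[leb] (Set.Icc u v).indicator fun _ => (1 : ℂ) := by
  have hne : ∀ᵐ t ∂leb, t ≠ u := by
    rw [ae_iff]
    simp
  have hpos : ∀ᵐ t ∂leb, 0 ≤ t := ae_restrict_mem measurableSet_Ici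
  filter_upwards [ContinuousLinearMap.coeFn_compLp (RCLike.ofRealCLM : ℝ →L[ℝ] ℂ) (increment u v),
    Lp.coeFn_sub (indicatorConstLp 2 (μ := leb) (s := Set.Icc 0 v) measurableSet_Icc
      (ne_top_of_le_ne_top (by simp) (Measure.restrict_apply_le _ _)) (1 : ℝ))
      (indicatorConstLp 2 (μ := leb) (s := Set.Icc 0 u) measurableSet_Icc
      (ne_top_of_le_ne_top (by simp) (Measure.restrict_apply_le _ _)) (1 : ℝ)),
    indicatorConstLp_coeFn (p := 2) (μ := leb) (s := Set.Icc 0 v) (hs := measurableSet_Icc)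
      (hμs := ne_top_of_le_ne_top (by simp) (Measure.restrict_apply_le _ _)) (c := (1 : ℝ)),
    indicatorConstLp_coeFn (p := 2) (μ := leb) (s := Set.Icc 0 u) (hs := measurableSet_Icc)
      (hμs := ne_top_of_le_ne_top (by simp) (Measure.restrict_apply_le _ _)) (c := (1 : ℝ)),
    hne, hpos] with t h1 h2 h3 h4 h5 h6
  rw [toHC, h1, increment, h2, Pi.sub_apply, h3, h4]
  simp only [Set.indicator_apply, Set.mem_Icc, h6, true_and]
  rcases lt_or_gt_of_ne h5 with h | h
  · simp [h.le, not_le.2 h, (h.le.trans huv)]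
  · simp [h.le, not_le.2 h]

lemma tensor_increment {n : ℕ} {u v : Fin n → ℝ} (huv : u ≤ v) :
    (tensor fun i => toHC (increment (u i) (v i))) =
      indicatorConstLp 2 (s := Set.Icc u v) measurableSet_Icc (box_ne_top u v) (1 : ℂ) := by
  induction n with
  | zero =>
    apply Lp.ext
    filter_upwards [indicatorConstLp_coeFn (p := 2) (μ := lebN 0) (s := Set.Icc u v)
      (hs := measurableSet_Icc) (hμs := box_ne_top u v) (c := (1 : ℂ)),
      Lp.coeFn_const (p := 2) (μ := lebN 0) (1 : ℂ)] with t h1 h2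
    rw [h1, tensor, h2, Set.indicator_of_mem]
    · rfl
    · exact ⟨fun i => i.elim0, fun i => i.elim0⟩
  | succ n ih =>
    have ih' := ih (u := Fin.tail u) (v := Fin.tail v) (fun i => huv i.succ)
    apply Lp.ext
    have e : tensor (fun i => toHC (increment (u i) (v i))) =
      prepend (toHC (increment (u 0) (v 0)))
        (indicatorConstLp 2 (s := Set.Icc (Fin.tail u) (Fin.tail v)) measurableSet_Icc
          (box_ne_top _ _) (1 : ℂ)) := by
      rw [← ih']; rfl
    rw [e]
    filter_upwards [indicatorConstLp_coeFn (p := 2) (μ := lebN (n + 1)) (s := Set.Icc u v)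
      (hs := measurableSet_Icc) (hμs := box_ne_top u v) (c := (1 : ℂ)),
      (tail_quasi n).ae (indicatorConstLp_coeFn (p := 2) (μ := lebN n)
        (s := Set.Icc (Fin.tail u) (Fin.tail v))
        (hs := measurableSet_Icc) (hμs := box_ne_top _ _) (c := (1 : ℂ))),
      (eval_zero_quasi n).ae (toHC_increment (huv 0)),
      (memLp_prepend (toHC (increment (u 0) (v 0)))
        (indicatorConstLp 2 (s := Set.Icc (Fin.tail u) (Fin.tail v)) measurableSet_Icc
          (box_ne_top _ _) (1 : ℂ))).1.coeFn_toLp] with t h1 h2 h3 h4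
    rw [prepend, h4, h1, h2, h3]
    have hiff : t ∈ Set.Icc u v ↔
        t 0 ∈ Set.Icc (u 0) (v 0) ∧ Fin.tail t ∈ Set.Icc (Fin.tail u) (Fin.tail v) := by
      simp only [Set.mem_Icc, Pi.le_def, Fin.forall_fin_succ, Fin.tail]
      tauto
    by_cases ha : t 0 ∈ Set.Icc (u 0) (v 0) <;>
      by_cases hb : Fin.tail t ∈ Set.Icc (Fin.tail u) (Fin.tail v) <;>
      simp [hiff, ha, hb]

lemma create_single (h : HC) (n : ℕ) (f : L2N n) :
    create h (lp.single 2 n f) = lp.single 2 (n + 1) (prepend h f) := by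
  apply lp.ext
  funext m
  cases m with
  | zero => rw [create_apply_zero, lp.single_apply_ne _ _ _ (Nat.succ_ne_zero n).symm]
  | succ m =>
    rw [create_apply_succ]
    by_cases hm : m = n
    · subst hm
      rw [lp.single_apply_self, lp.single_apply_self]
    · rw [lp.single_apply_ne _ _ _ hm, lp.single_apply_ne _ _ _ (by omega)]
      simpa using prepend_smul h 0 (0 : L2N m)

/-- A product of semicircular elements of orthogonal vectors sends the vacuum to an elementary
tensor. -/
lemma wordVec_of_orthogonal {n : ℕ} (h : Fin n → HR)
    (ho : Pairwise fun i j => ⟪toHC (h i), toHC (h j)⟫_ℂ = 0) :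
    wordVec (List.ofFn h) = lp.single 2 n (tensor fun i => toHC (h i)) := by
  induction n with
  | zero => rfl
  | succ n ih =>
    have ih' := ih (Fin.tail h) fun i j hij => ho (by simpa using hij)
    have e : (fun i => h (Fin.succ i)) = Fin.tail h := rfl
    rw [List.ofFn_succ, wordVec_cons, e, ih', create_single]
    -- Annihilation contributes nothing: it kills the vacuum, and otherwise contracts `h 0` with the
    -- first tensor factor, to which it is orthogonal.
    have hz : ContinuousLinearMap.adjoint (create (toHC (h 0)))
        (lp.single 2 n (tensor fun i => toHC (Fin.tail h i)) : Fock) = 0 := by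
      cases n with
      | zero => exact adjoint_create_vac _
      | succ n =>
        rw [tensor, ← create_single, adjoint_create_create, Fin.tail, ho (by simp), zero_smul]
    rw [hz, add_zero]
    rfl

lemma inner_increment_eq_zero {u v u' v' : ℝ} (huv : u ≤ v) (huv' : u' ≤ v')
    (hd : Disjoint (Set.Icc u v) (Set.Icc u' v')) :
    ⟪toHC (increment u v), toHC (increment u' v')⟫_ℂ = 0 := by
  rw [L2.inner_def, ← integral_zero ℝ ℂ (μ := leb)]
  refine integral_congr_ae ?_
  filter_upwards [toHC_increment huv, toHC_increment huv'] with t h1 h2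
  rw [h1, h2]
  by_cases ht : t ∈ Set.Icc u v
  · simp [Set.indicator_of_notMem (Set.disjoint_left.1 hd ht)]
  · simp [Set.indicator_of_notMem ht]

/-- If `x` lay in both intervals, the corner `u` with its coordinates `i` and `j` replaced by `x`
would be a diagonal point of the box. -/
lemma disjoint_of_disjoint_diagonals {n : ℕ} {u v : Fin n → ℝ} (huv : u ≤ v)
    (hd : Disjoint (Set.Icc u v) (diagonals n)) {i j : Fin n} (hij : i ≠ j) :
    Disjoint (Set.Icc (u i) (v i)) (Set.Icc (u j) (v j)) := by
  refine Set.disjoint_left.2 fun x hi hj => ?_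
  have hx : Function.update (Function.update u i x) j x ∈ diagonals n :=
    ⟨i, j, hij, by simp [hij]⟩
  refine Set.disjoint_left.1 hd ?_ hx
  constructor <;> intro k <;> by_cases hk : k = j
  · subst hk; simpa using hj.1
  · by_cases hk' : k = i
    · subst hk'; simpa [hk] using hi.1
    · simp [hk, hk']
  · subst hk; simpa using hj.2
  · by_cases hk' : k = i
    · subst hk'; simpa [hk] using hi.2
    · simpa [hk, hk'] using huv k

/-- The image of a box under `I_n` is the indicator of the box, in the `n`-th chaos. -/
lemma toFock_box {n : ℕ} {u v : Fin n → ℝ} (huv : u ≤ v)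
    (hd : Disjoint (Set.Icc u v) (diagonals n)) :
    toFock (cls fun _ => (List.ofFn fun i => brownian (v i) - brownian (u i)).prod) =
      lp.single 2 n
        (indicatorConstLp 2 (s := Set.Icc u v) measurableSet_Icc (box_ne_top u v) (1 : ℂ)) := by
  rw [toFock_cls, ← tensor_increment huv,
    ← wordVec_of_orthogonal (fun i => increment (u i) (v i)) fun i j hij =>
      inner_increment_eq_zero (huv i) (huv j)
        (disjoint_of_disjoint_diagonals huv hd hij)]
  simp only [wordVec, evalWord, List.map_ofFn, Function.comp_def, brownian_sub]

/-- The relation is the kernel of a continuous linear map, so it passes from boxes to their span and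
to the closure of the graph. -/
theorem IsWignerIntegral.toFock_eq {n : ℕ} {f : L2N n} {X : L2SC 1}
    (h : IsWignerIntegral n f X) : toFock X = lp.single 2 n f := by
  let L : L2N n × L2SC 1 →L[ℂ] Fock :=
    toFock.comp (ContinuousLinearMap.snd ℂ _ _) -
      (lp.singleContinuousLinearMap ℂ (fun n => L2N n) 2 n).comp (ContinuousLinearMap.fst ℂ _ _)
  have hle : (simpleIntegralGraph n).topologicalClosure ≤ LinearMap.ker L.toLinearMap := by
    refine Submodule.topologicalClosure_minimal _ (Submodule.span_le.2 ?_) L.isClosed_ker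
    rintro ⟨p, q⟩ ⟨u, v, -, huv, hd, rfl, rfl⟩
    exact sub_eq_zero.2 (toFock_box huv hd)
  exact sub_eq_zero.1 (hle h)

/-! ### Vacuum expectations of the iterated gradients -/

/-- The vacuum expectation `U ↦ τ^{⊗ (n+1)}(U)` on `L²(ℝ₊ⁿ; L²(SC^{⊗ (n+1)}))`. -/
def tauM (n : ℕ) : M n →L[ℂ] L2N n := (tau (n + 1)).compLpL 2 (lebN n)

lemma tauM_coeFn {n : ℕ} (U : M n) : ∀ᵐ t ∂lebN n, tauM n U t = tau (n + 1) (U t) :=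
  ContinuousLinearMap.coeFn_compLpL _ U

lemma tauM_emult {n : ℕ} (h : Fin n → HR) (A : Fin (n + 1) → SCAlg) :
    tauM n (emult h A) = (∏ i, trace (A i)) • tensor fun i => toHC (h i) := by
  apply Lp.ext
  filter_upwards [tauM_coeFn (emult h A), ContinuousLinearMap.coeFn_compLp
      (ContinuousLinearMap.toSpanSingleton ℂ (cls A)) (tensor fun i => toHC (h i)),
    Lp.coeFn_smul (∏ i, trace (A i)) (tensor fun i => toHC (h i))] with t h1 h2 h3
  rw [h1, emult, h2, h3, ContinuousLinearMap.toSpanSingleton_apply, map_smul, cls, tau_coe,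
    traceN_etensor, Pi.smul_apply, smul_eq_mul, smul_eq_mul, mul_comm]

/-- The projection onto the `n`-th chaos. -/
def chaos (n : ℕ) : L2SC 1 →L[ℂ] L2N n :=
  (lp.evalCLM ℂ (fun n => L2N n) 2 n).comp toFock

lemma chaos_apply (n : ℕ) (X : L2SC 1) : chaos n X = toFock X n := rfl

theorem tauM_gradPoly (n : ℕ) (P : Poly) : tauM n (gradPoly n P) = chaos n (eval P) := by
  induction P using Finsupp.induction_linear with
  | zero => simp
  | add P Q hP hQ => simp only [map_add, hP, hQ]
  | single w c =>
    rw [gradPoly, eval, Finsupp.linearCombination_single, Finsupp.linearCombination_single,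
      map_smul, map_smul, chaos_apply, toFock_cls, map_list_sum, List.map_map]
    have := wordVec_apply n w
    rw [wordVec] at this
    rw [this]
    simp only [Function.comp_def, tauM_emult]
    rfl

/-- A closed linear condition on `(F, U)` that holds on the graph over polynomials holds on its
closure. -/
theorem IsGrad.tauM_eq {n : ℕ} {F : L2SC 1} {U : M n} (h : IsGrad n F U) :
    tauM n U = chaos n F := by
  let L : L2SC 1 × M n →L[ℂ] L2N n :=
    (tauM n).comp (ContinuousLinearMap.snd ℂ _ _) - (chaos n).comp (ContinuousLinearMap.fst ℂ _ _)
  have hle : (LinearMap.range (eval.prod (gradPoly n))).topologicalClosure ≤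
      LinearMap.ker L.toLinearMap := by
    refine Submodule.topologicalClosure_minimal _ ?_ L.isClosed_ker
    rintro _ ⟨P, rfl⟩
    exact sub_eq_zero.2 (tauM_gradPoly n P)
  exact sub_eq_zero.1 (hle h)

theorem IsSymGrad.tauM_eq {n : ℕ} {F : L2SC 1} {V : M n} (h : IsSymGrad n F V) :
    tauM n V = (n.factorial : ℂ) • chaos n F := by
  let L : L2SC 1 × M n →L[ℂ] L2N n :=
    (tauM n).comp (ContinuousLinearMap.snd ℂ _ _) -
      ((n.factorial : ℂ) • chaos n).comp (ContinuousLinearMap.fst ℂ _ _)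
  have hle : (LinearMap.range (eval.prod (symPoly n))).topologicalClosure ≤
      LinearMap.ker L.toLinearMap := by
    refine Submodule.topologicalClosure_minimal _ ?_ L.isClosed_ker
    rintro _ ⟨P, rfl⟩
    refine sub_eq_zero.2 ?_
    change tauM n ((n.factorial : ℂ) • gradPoly n P) = (n.factorial : ℂ) • chaos n (eval P)
    rw [map_smul, tauM_gradPoly]
  exact sub_eq_zero.1 (hle h)

/-- Chaos components are read off from a Wigner chaos expansion. -/
theorem chaos_eq_of_hasSum {F : L2SC 1} {f : (n : ℕ) → L2N n} {I : ℕ → L2SC 1}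
    (hI : ∀ n, IsWignerIntegral n (f n) (I n)) (hsum : HasSum I F) (n : ℕ) : chaos n F = f n := by
  refine (hsum.mapL (chaos n)).unique ?_
  have h : ∀ m ≠ n, chaos n (I m) = 0 := fun m hm => by
    rw [chaos_apply, (hI m).toFock_eq, lp.single_apply_ne _ _ _ hm.symm]
  have hn : chaos n (I n) = f n := by
    rw [chaos_apply, (hI n).toFock_eq, lp.single_apply_self]
  rw [← hn]
  exact hasSum_single n h

/-! ### Existence of the derivatives -/

lemma norm_gradPoly_zero (P : Poly) : ‖gradPoly 0 P‖ = ‖eval P‖ := by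
  have h : gradPoly 0 P = Lp.const 2 (lebN 0) (eval P) := by
    induction P using Finsupp.induction_linear with
    | zero => simp
    | add P Q hP hQ => simp only [map_add, hP, hQ]
    | single w c =>
      rw [gradPoly, eval, Finsupp.linearCombination_single, Finsupp.linearCombination_single]
      simp only [gradWordN, List.map_cons, List.map_nil, List.sum_cons, List.sum_nil, add_zero]
      apply Lp.ext
      filter_upwards [Lp.coeFn_smul c (emult Fin.elim0 fun _ : Fin 1 => evalWord w),
        ContinuousLinearMap.coeFn_compLp
          (ContinuousLinearMap.toSpanSingleton ℂ (cls fun _ : Fin 1 => evalWord w))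
          (tensor fun i => toHC (Fin.elim0 i)),
        Lp.coeFn_const (p := 2) (μ := lebN 0) (1 : ℂ),
        Lp.coeFn_const (p := 2) (μ := lebN 0) (c • cls fun _ : Fin 1 => evalWord w)]
        with t h1 h2 h3 h4
      rw [h1, h4, Pi.smul_apply, emult, h2, tensor, h3]
      simp
  -- `lebN 0` has total mass one, so a constant has its own norm.
  rw [h, Lp.norm_const' _ _ _ two_ne_zero ENNReal.ofNat_ne_top]
  simp [measureReal_def]

lemma norm_symPoly_le_sobolevNorm {n k : ℕ} (hn : n ≤ k) (P : Poly) :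
    ‖symPoly n P‖ ≤ sobolevNorm k P := by
  refine Real.le_sqrt_of_sq_le ?_
  -- The sum in `sobolevNorm` starts at `j = 1`; order zero is controlled by the separate term
  -- `‖eval P‖ ^ 2`.
  rcases Nat.eq_zero_or_pos n with rfl | hpos
  · have : ‖symPoly 0 P‖ = ‖eval P‖ := by
      rw [← norm_gradPoly_zero]
      simp [symPoly]
    rw [this]
    exact le_add_of_nonneg_right (Finset.sum_nonneg fun _ _ => sq_nonneg _)
  · refine (Finset.single_le_sum (f := fun j => ‖symPoly j P‖ ^ 2) (fun _ _ => sq_nonneg _)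
      (Finset.mem_Icc.2 ⟨hpos, hn⟩)).trans (le_add_of_nonneg_left (sq_nonneg _))

/-- The Sobolev norm dominates the norm of `Dⁿ`, so along a Sobolev–Cauchy sequence the derivatives
converge as well. -/
theorem exists_isSymGrad {n k : ℕ} (hn : n ≤ k) {F : L2SC 1} (hF : F ∈ sobolev k) :
    ∃ V, IsSymGrad n F V := by
  obtain ⟨P, hP, hC⟩ := hF
  have hc : CauchySeq fun m => symPoly n (P m) := by
    refine Metric.cauchySeq_iff.2 fun ε hε => ?_
    obtain ⟨N, hN⟩ := hC ε hε
    refine ⟨N, fun m hm m' hm' => ?_⟩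
    rw [dist_eq_norm, ← map_sub]
    exact (norm_symPoly_le_sobolevNorm hn _).trans_lt (hN m hm m' hm')
  obtain ⟨V, hV⟩ := cauchySeq_tendsto_of_complete hc
  refine ⟨V, mem_closure_of_tendsto (hP.prodMk_nhds hV) (Eventually.of_forall fun m => ?_)⟩
  exact ⟨P m, rfl⟩

/-- Rescaling the second coordinate is continuous and carries the graph of `Dⁿ` into that of `∇ⁿ`,
hence also the closures. -/
lemma IsSymGrad.isGrad {n : ℕ} {F : L2SC 1} {V : M n} (h : IsSymGrad n F V) :
    IsGrad n F ((n.factorial : ℂ)⁻¹ • V) := by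
  let L : L2SC 1 × M n →L[ℂ] L2SC 1 × M n :=
    (ContinuousLinearMap.fst ℂ _ _).prod ((n.factorial : ℂ)⁻¹ • ContinuousLinearMap.snd ℂ _ _)
  refine map_mem_closure L.continuous h (f := L) ?_
  rintro _ ⟨P, rfl⟩
  refine ⟨P, Prod.ext rfl ?_⟩
  change gradPoly n P = (n.factorial : ℂ)⁻¹ • (n.factorial : ℂ) • gradPoly n P
  rw [inv_smul_smul₀ (Nat.cast_ne_zero.2 n.factorial_ne_zero)]

end Wigner

end

/-! ### The free Stroock formula -/

theorem mainTheorem1 (F : Wigner.L2SC 1) (hF : F ∈ Wigner.sobolevInf)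
    (f : (n : ℕ) → Wigner.L2N n) (I : ℕ → Wigner.L2SC 1)
    (hI : ∀ n, Wigner.IsWignerIntegral n (f n) (I n)) (hsum : HasSum I F) (n : ℕ) :
    ((∃ U : Wigner.M n, Wigner.IsGrad n F U) ∧
      ∀ U : Wigner.M n, Wigner.IsGrad n F U →
        ∀ᵐ t ∂(Wigner.lebN n), f n t = Wigner.tau (n + 1) (U t)) ∧
    ((∃ V : Wigner.M n, Wigner.IsSymGrad n F V) ∧
      ∀ V : Wigner.M n, Wigner.IsSymGrad n F V →
        ∀ᵐ t ∂(Wigner.lebN n), f n t = 1 / (n.factorial : ℂ) * Wigner.tau (n + 1) (V t)) := by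
  have hn : Wigner.chaos n F = f n := Wigner.chaos_eq_of_hasSum hI hsum n
  -- The intersection defining `sobolevInf` runs over `k ≥ 1`, so `max n 1` also covers `n = 0`.
  obtain ⟨V, hV⟩ := Wigner.exists_isSymGrad (le_max_left n 1)
    (Set.mem_iInter₂.1 hF (max n 1) (le_max_right n 1))
  refine ⟨⟨⟨_, hV.isGrad⟩, fun U hU => ?_⟩, ⟨⟨V, hV⟩, fun W hW => ?_⟩⟩
  · have h := hU.tauM_eq
    rw [hn] at h
    filter_upwards [Wigner.tauM_coeFn U] with t ht
    rw [← ht, h]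
  · have h := hW.tauM_eq
    rw [hn] at h
    filter_upwards [Wigner.tauM_coeFn W, Lp.coeFn_smul (n.factorial : ℂ) (f n)] with t ht hs
    rw [← ht, h, hs, Pi.smul_apply, smul_eq_mul, one_div,
      inv_mul_cancel_left₀ (Nat.cast_ne_zero.2 n.factorial_ne_zero)]
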